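/- Let $\mathcal H$ be a separable complex Hilbert space and let $G$ be a positive semidefinite, self-adjoint, unbounded, densely defined operator on $\mathcal H$ with $\inf\{\|G\varphi\| : \varphi\in\mathcal D(G),\ \|\varphi\|=1\}=0$. A linear operator $A:\mathcal D(\sqrt G)\to\mathcal H$ is called $\sqrt G$-bounded if there are $a,b\ge 0$ with $$\|A\varphi\|^2\le a^2\|\varphi\|^2+b^2\|\sqrt G\varphi\|^2\quad\text{for all }\varphi\in\mathcal D(\sqrt G);$$ the infimum of all $b\geq 0$ that are possible here (with some $a\ge 0$) is the $\sqrt G$-bound of $A$. Let $\mathfrak B_G(\mathcal H)$ be the set of all $\sqrt G$-bounded operators and $\mathfrak B^0_G(\mathcal H)$ the set of those with $\sqrt G$-bound $0$. For $E>0$ put $$\|A\|^G_E=\sup\{\|A\varphi\| : \varphi\in\mathcal D(\sqrt G),\ \|\varphi\|=1,\ \|\sqrt G\varphi\|^2\le E\}.$$ Let $\mathcal K$ be a nonzero separable complex Hilbert space, let $\mathcal H\otimes\mathcal K$ be the Hilbert space tensor product, and let $\sqrt G\otimes I_{\mathcal K}$ be the self-adjoint operator that is the closure of the operator $\varphi\otimes\psi\mapsto\sqrt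 G\varphi\otimes\psi$ on the linear span of all $\varphi\otimes\psi$ with $\varphi\in\mathcal D(\sqrt G)$, $\psi\in\mathcal K$. For $E>0$ put $$\mathcal V_E=\{\eta\in\mathcal D(\sqrt G\otimes I_{\mathcal K}) : \|(\sqrt G\otimes I_{\mathcal K})\eta\|^2\le E\}.$$ For every $A\in\mathfrak B_G(\mathcal H)$ the operator $\varphi\otimes\psi\mapsto A\varphi\otimes\psi$ on the linear span of all $\varphi\otimes\psi$ with $\varphi\in\mathcal D(\sqrt G)$, $\psi\in\mathcal K$ has a unique linear $\sqrt G\otimes I_{\mathcal K}$-bounded extension $A\otimes I_{\mathcal K}$ to $\mathcal D(\sqrt G\otimes I_{\mathcal K})$, and: 1. If $A\in\mathfrak B^0_G(\mathcal H)$, then for every $E>0$ the operator $A\otimes I_{\mathcal K}$ is uniformly continuous on $\mathcal V_E$ (with respect to the norm of $\mathcal H\otimes\mathcal K$). Quantitatively, $$\|(A\otimes I_{\mathcal K})(\eta-\theta)\|\le\varepsilon\,\|A\|^G_{4E/\varepsilon^2}$$ for all $\varepsilon>0$ and all $\eta,\theta\in\mathcal V_E$ with $\|\eta-\theta\|\le\varepsilon$,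 and $\varepsilon\,\|A\|^G_{4E/\varepsilon^2}\to 0$ as $\varepsilon\to 0^+$. 2. If $A\in\mathfrak B_G(\mathcal H)\setminus\mathfrak B^0_G(\mathcal H)$, then for every $E>0$ the operator $A\otimes I_{\mathcal K}$ is not continuous on $\mathcal V_E$. -/

import Mathlib

open scoped TensorProduct InnerProductSpace Topology

section SquareRoot

variable {H : Type*} [NormedAddCommGroup H] [InnerProductSpace ℂ H]

/-- A (partially defined) linear operator `T` is positive semidefinite:
`⟨φ, T φ⟩ ≥ 0` for all `φ` in the domain. -/
def IsPosSemidefOp (T : H →ₗ.[ℂ] H) : Prop :=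
  ∀ φ : T.domain, 0 ≤ (inner ℂ (φ : H) (T φ)).re

/-- `S` is a positive square root of `G`: it is self-adjoint, positive semidefinite, and
`S ∘ S = G` as partially defined operators (equality of domains included). -/
structure IsPosSqrtOp [CompleteSpace H] (G S : H →ₗ.[ℂ] H) : Prop where
  isSelfAdjoint : IsSelfAdjoint S
  isPosSemidef : IsPosSemidefOp S
  sq_eq : ∀ x y : H, (x, y) ∈ G.graph ↔ ∃ z : H, (x, z) ∈ S.graph ∧ (z, y) ∈ S.graph

theorem norm_le_of_isPosSemidefOp {G : H →ₗ.[ℂ] H} (hp : IsPosSemidefOp G) (x : G.domain) :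
    ‖(x : H)‖ ≤ ‖(x : H) + G x‖ ∧ ‖G x‖ ≤ ‖(x : H) + G x‖ := by
  have h := @norm_add_sq ℂ H _ _ _ (x : H) (G x)
  have h2 := hp x
  have h3 : RCLike.re (inner ℂ (x : H) (G x)) = (inner ℂ (x : H) (G x)).re := rfl
  rw [h3] at h
  constructor
  · refine abs_le_of_sq_le_sq' ?_ (norm_nonneg _) |>.2
    nlinarith [sq_nonneg ‖G x‖]
  · refine abs_le_of_sq_le_sq' ?_ (norm_nonneg _) |>.2
    nlinarith [sq_nonneg ‖(x : H)‖]

variable [CompleteSpace H]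

theorem exists_add_apply_eq {G : H →ₗ.[ℂ] H} (hG : IsSelfAdjoint G) (hp : IsPosSemidefOp G)
    (y : H) : ∃ x : G.domain, (x : H) + G x = y := by
  have hdense := hG.dense_domain
  let J : G.domain →ₗ[ℂ] H := G.domain.subtype + G.toFun
  let L : G.graph →ₗ[ℂ] H :=
    (LinearMap.fst ℂ H H + LinearMap.snd ℂ H H).comp G.graph.subtype
  have hLc : UniformContinuous L := by
    have h1 : UniformContinuous (fun p : H × H => p.1 + p.2) := uniformContinuous_add
    exact h1.comp uniformContinuous_subtype_val
  have hLa : AntilipschitzWith 1 L := by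
    refine AddMonoidHomClass.antilipschitz_of_bound L fun p => ?_
    obtain ⟨⟨a, b⟩, hab⟩ := p
    obtain ⟨x, hx1, hx2⟩ := (LinearPMap.mem_graph_iff G).1 hab
    dsimp only at hx1 hx2
    subst hx1
    subst hx2
    have := norm_le_of_isPosSemidefOp hp x
    simpa [L, Prod.norm_def] using this
  have : CompleteSpace G.graph := hG.isClosed.completeSpace_coe
  have hcl : IsClosed (Set.range L) := hLa.isClosed_range hLc
  have hrange : (LinearMap.range J : Set H) = Set.range L := by
    ext z
    constructor
    · rintro ⟨x, rfl⟩
      exact ⟨⟨((x : H), G x), LinearPMap.mem_graph G x⟩, by simp [L, J]⟩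
    · rintro ⟨⟨⟨a, b⟩, hab⟩, rfl⟩
      obtain ⟨x, hx1, hx2⟩ := (LinearPMap.mem_graph_iff G).1 hab
      dsimp only at hx1 hx2
      subst hx1
      subst hx2
      exact ⟨x, by simp [L, J]⟩
  have hcl' : IsClosed (LinearMap.range J : Set H) := by rw [hrange]; exact hcl
  have : CompleteSpace (LinearMap.range J) := hcl'.completeSpace_coe
  have hbot : (LinearMap.range J)ᗮ = ⊥ := by
    rw [Submodule.eq_bot_iff]
    intro z hz
    rw [Submodule.mem_orthogonal'] at hz
    have hz' : ∀ x : G.domain, inner ℂ (-z) (x : H) = inner ℂ z (G x) := by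
      intro x
      have h := hz _ ⟨x, rfl⟩
      simp only [J, LinearMap.add_apply, Submodule.subtype_apply, inner_add_right] at h
      rw [inner_neg_left]
      exact neg_eq_of_add_eq_zero_right h
    have hzm : z ∈ G.adjoint.domain := LinearPMap.mem_adjoint_domain_of_exists z ⟨-z, hz'⟩
    have hval : G.adjoint ⟨z, hzm⟩ = -z := LinearPMap.adjoint_apply_eq hdense _ hz'
    have hle : G.adjoint ≤ G := le_of_eq (LinearPMap.isSelfAdjoint_def.1 hG)
    have hzG : z ∈ G.domain := hle.1 hzm
    have hval2 : G ⟨z, hzG⟩ = -z := by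
      rw [← hval]
      exact (hle.2 rfl).symm
    have := (norm_le_of_isPosSemidefOp hp ⟨z, hzG⟩).1
    rw [hval2] at this
    simpa using this
  have htop := (Submodule.orthogonal_eq_bot_iff).1 hbot
  have : y ∈ LinearMap.range J := by rw [htop]; trivial
  obtain ⟨x, hx⟩ := this
  exact ⟨x, by simpa [J] using hx⟩

/-- The inverse of `1 + G`. -/
theorem exists_resolvent {G : H →ₗ.[ℂ] H} (hG : IsSelfAdjoint G) (hp : IsPosSemidefOp G) :
    ∃ R : H →L[ℂ] H, 0 ≤ R ∧ 0 ≤ 1 - R ∧ Function.Injective R ∧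
      ∀ x y : H, (x, y) ∈ G.graph ↔ R (x + y) = x := by
  let J : G.domain →ₗ[ℂ] H := G.domain.subtype + G.toFun
  have hJ : ∀ x : G.domain, J x = (x : H) + G x := fun x => rfl
  have hinj : Function.Injective J := by
    rw [injective_iff_map_eq_zero]
    intro x hx
    have := (norm_le_of_isPosSemidefOp hp x).1
    rw [← hJ, hx, norm_zero] at this
    exact Subtype.ext (norm_le_zero_iff.1 this)
  have hsurj : Function.Surjective J := fun y => exists_add_apply_eq hG hp y
  let e := LinearEquiv.ofBijective J ⟨hinj, hsurj⟩
  have he : ∀ y : H, ((e.symm y : G.domain) : H) + G (e.symm y) = y := fun y =>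
    e.apply_symm_apply y
  let R : H →L[ℂ] H := (G.domain.subtype.comp e.symm.toLinearMap).mkContinuous 1 fun y => by
    have := (norm_le_of_isPosSemidefOp hp (e.symm y)).1
    rw [he] at this
    simpa using this
  have hR : ∀ y, R y = ((e.symm y : G.domain) : H) := fun y => rfl
  have hGR : ∀ y, G (e.symm y) = y - R y := fun y => by
    rw [hR, eq_sub_iff_add_eq', he]
  have hsym : G.IsFormalAdjoint G := by
    have := LinearPMap.adjoint_isFormalAdjoint hG.dense_domain
    rwa [LinearPMap.isSelfAdjoint_def.1 hG] at this
  have hRsym : ∀ x y, inner ℂ (R x) y = inner ℂ x (R y) := by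
    intro x y
    have h := hsym (e.symm x) (e.symm y)
    rw [hGR, hGR, ← hR, ← hR, inner_sub_left, inner_sub_right] at h
    exact (sub_left_inj.1 h).symm
  have hre : ∀ y, 0 ≤ (inner ℂ (R y) (y - R y)).re := by
    intro y
    have := hp (e.symm y)
    rwa [hGR] at this
  have hRR : ∀ y, (0 : ℝ) ≤ (inner ℂ (R y) (R y)).re := fun y => by
    have := @inner_self_nonneg ℂ H _ _ _ (R y)
    exact this
  refine ⟨R, ?_, ?_, ?_, ?_⟩
  · rw [ContinuousLinearMap.nonneg_iff_isPositive, ContinuousLinearMap.isPositive_def]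
    refine ⟨fun x y => hRsym x y, fun y => ?_⟩
    have h1 := hre y
    have h2 := hRR y
    rw [inner_sub_right, Complex.sub_re] at h1
    change 0 ≤ (inner ℂ (R y) y).re
    linarith
  · rw [ContinuousLinearMap.nonneg_iff_isPositive, ContinuousLinearMap.isPositive_def]
    refine ⟨fun x y => ?_, fun y => ?_⟩
    · change inner ℂ (x - R x) y = inner ℂ x (y - R y)
      rw [inner_sub_left, inner_sub_right, hRsym]
    · change 0 ≤ (inner ℂ (y - R y) y).re
      have h1 := hre y
      have h2 : 0 ≤ (inner ℂ (y - R y) (y - R y)).re := by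
        have := @inner_self_nonneg ℂ H _ _ _ (y - R y)
        exact this
      have h3 : inner ℂ (y - R y) y = inner ℂ (y - R y) (y - R y) + inner ℂ (y - R y) (R y) := by
        rw [← inner_add_right, sub_add_cancel]
      have h4 : (inner ℂ (y - R y) (R y)).re = (inner ℂ (R y) (y - R y)).re :=
        inner_re_symm (𝕜 := ℂ) _ _
      rw [h3, Complex.add_re, h4]
      linarith
  · intro x y hxy
    have : e.symm x = e.symm y := Subtype.ext hxy
    exact e.symm.injective this
  · intro x y
    constructor
    · intro h
      obtain ⟨u, hu1, hu2⟩ := (LinearPMap.mem_graph_iff G).1 h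
      dsimp only at hu1 hu2
      subst hu1
      subst hu2
      rw [hR]
      have : e.symm (J u) = u := e.symm_apply_apply u
      rw [hJ] at this
      rw [this]
    · intro h
      refine (LinearPMap.mem_graph_iff G).2 ⟨e.symm (x + y), h, ?_⟩
      rw [hGR, h]
      simp

/-- Every positive semidefinite self-adjoint operator has a positive square root. -/
theorem exists_isPosSqrtOp {G : H →ₗ.[ℂ] H} (hG : IsSelfAdjoint G) (hp : IsPosSemidefOp G) :
    ∃ S : H →ₗ.[ℂ] H, IsPosSqrtOp G S := by
  obtain ⟨R, hR0, hR1, hRinj, hRG⟩ := exists_resolvent hG hp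
  let B := CFC.sqrt R
  let C := CFC.sqrt (1 - R)
  have hB0 : 0 ≤ B := CFC.sqrt_nonneg R
  have hC0 : 0 ≤ C := CFC.sqrt_nonneg (1 - R)
  have hBB : B * B = R := CFC.sqrt_mul_sqrt_self R hR0
  have hCC : C * C = 1 - R := CFC.sqrt_mul_sqrt_self (1 - R) hR1
  have hcomm : Commute B C := by
    have h1 : Commute (1 - R) R := (Commute.one_left R).sub_left (Commute.refl R)
    have h2 : Commute B (1 - R) := by
      have := (Commute.symm h1).cfcₙ_nnreal NNReal.sqrt
      exact this
    have h3 := (Commute.symm h2).cfcₙ_nnreal NNReal.sqrt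
    exact Commute.symm h3
  have hBC0 : 0 ≤ B * C := Commute.mul_nonneg hB0 hC0 hcomm
  have hBsym : ∀ x y, inner ℂ (B x) y = inner ℂ x (B y) :=
    ((ContinuousLinearMap.nonneg_iff_isPositive B).1 hB0).isSymmetric
  have hCsym : ∀ x y, inner ℂ (C x) y = inner ℂ x (C y) :=
    ((ContinuousLinearMap.nonneg_iff_isPositive C).1 hC0).isSymmetric
  have hBBa : ∀ x, B (B x) = R x := fun x => by rw [← hBB]; rfl
  have hCCa : ∀ x, C (C x) = x - R x := fun x => by
    have := congrArg (fun T : H →L[ℂ] H => T x) hCC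
    exact this
  have hBCa : ∀ x, B (C x) = C (B x) := fun x => by
    have := congrArg (fun T : H →L[ℂ] H => T x) hcomm.eq
    exact this
  have hBinj : Function.Injective B := by
    intro x y hxy
    apply hRinj
    rw [← hBBa, ← hBBa, hxy]
  let e := LinearEquiv.ofInjective (B : H →ₗ[ℂ] H) hBinj
  let S : H →ₗ.[ℂ] H :=
    { domain := LinearMap.range (B : H →ₗ[ℂ] H)
      toFun := (C : H →ₗ[ℂ] H).comp e.symm.toLinearMap }
  have hmem : ∀ u : H, B u ∈ S.domain := fun u => ⟨u, rfl⟩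
  have hdom : ∀ x : S.domain, ∃ u : H, B u = x := fun x => x.2
  have hSB : ∀ (x : S.domain) (u : H), B u = x → S x = C u := by
    rintro ⟨x, hx⟩ u rfl
    have : e.symm ⟨B u, hx⟩ = u := e.symm_apply_apply u
    change C (e.symm ⟨B u, hx⟩) = C u
    rw [this]
  have hgr : ∀ x z : H, (x, z) ∈ S.graph ↔ ∃ u, B u = x ∧ C u = z := by
    intro x z
    rw [LinearPMap.mem_graph_iff]
    constructor
    · rintro ⟨w, h1, h2⟩
      obtain ⟨u, hu⟩ := hdom w
      exact ⟨u, hu.trans h1, (hSB w u hu).symm.trans h2⟩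
    · rintro ⟨u, rfl, rfl⟩
      exact ⟨⟨B u, hmem u⟩, rfl, hSB _ u rfl⟩
  have hform : S.IsFormalAdjoint S := by
    intro x y
    obtain ⟨u, hu⟩ := hdom x
    obtain ⟨v, hv⟩ := hdom y
    rw [hSB x u hu, hSB y v hv, ← hu, ← hv, hCsym, ← hBCa, hBsym]
  have hdense : Dense (S.domain : Set H) := by
    rw [Submodule.dense_iff_topologicalClosure_eq_top,
      Submodule.topologicalClosure_eq_top_iff, Submodule.eq_bot_iff]
    intro z hz
    rw [Submodule.mem_orthogonal'] at hz
    apply hBinj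
    rw [map_zero]
    have := hz (B (B z)) (hmem (B z))
    rw [← hBsym] at this
    exact inner_self_eq_zero.1 this
  refine ⟨S, ?_, ?_, ?_⟩
  · rw [LinearPMap.isSelfAdjoint_def]
    have hle : S ≤ S.adjoint := LinearPMap.IsFormalAdjoint.le_adjoint hdense hform
    refine (LinearPMap.eq_of_le_of_domain_eq hle (le_antisymm hle.1 ?_)).symm
    intro y hy
    have hadj := LinearPMap.adjoint_isFormalAdjoint hdense ⟨y, hy⟩
    set w := S.adjoint ⟨y, hy⟩ with hw
    have key : B w = C y := by
      apply ext_inner_right ℂ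
      intro x
      have := hadj ⟨B x, hmem x⟩
      rw [hSB _ x rfl] at this
      change inner ℂ w (B x) = inner ℂ y (C x) at this
      rw [hBsym, this, hCsym]
    refine ⟨B y + C w, ?_⟩
    change B (B y + C w) = y
    rw [map_add, hBCa, key, hBBa, hCCa]
    abel
  · intro x
    obtain ⟨u, hu⟩ := hdom x
    rw [hSB x u hu, ← hu]
    have := ((ContinuousLinearMap.nonneg_iff_isPositive (B * C)).1 hBC0).re_inner_nonneg_right u
    change 0 ≤ (inner ℂ u (B (C u))).re at this
    change 0 ≤ (inner ℂ (B u) (C u)).re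
    rwa [hBsym]
  · intro x y
    rw [hRG]
    constructor
    · intro h
      refine ⟨B (C (x + y)), (hgr _ _).2 ⟨B (x + y), ?_, ?_⟩, (hgr _ _).2 ⟨C (x + y), rfl, ?_⟩⟩
      · rw [hBBa, h]
      · rw [hBCa]
      · rw [hCCa, h]
        abel
    · rintro ⟨z, hxz, hzy⟩
      obtain ⟨u, rfl, rfl⟩ := (hgr _ _).1 hxz
      obtain ⟨v, hv, rfl⟩ := (hgr _ _).1 hzy
      rw [← hBBa, map_add, hBBa, hBCa, hv, hCCa]
      congr 1
      abel

open scoped Classical in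
/-- The square root `√G` of an operator `G` (positive semidefinite and self-adjoint in all uses). -/
noncomputable def sqrtOp (G : H →ₗ.[ℂ] H) : H →ₗ.[ℂ] H :=
  if h : ∃ S : H →ₗ.[ℂ] H, IsPosSqrtOp G S then h.choose else G

theorem isPosSqrtOp_sqrtOp {G : H →ₗ.[ℂ] H} (hG : IsSelfAdjoint G) (hp : IsPosSemidefOp G) :
    IsPosSqrtOp G (sqrtOp G) := by
  have h := exists_isPosSqrtOp hG hp
  rw [sqrtOp, dif_pos h]
  exact h.choose_spec

end SquareRoot

section RelativelyBounded

variable {H H' : Type*} [NormedAddCommGroup H] [InnerProductSpace ℂ H]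
  [NormedAddCommGroup H'] [InnerProductSpace ℂ H']

/-- The set of all pairs `(a, b)` of nonnegative numbers such that
`‖A φ‖² ≤ a² ‖φ‖² + b² ‖S φ‖²` for all `φ` in the domain of `S`. -/
def relBoundPairs (S : H →ₗ.[ℂ] H) (A : S.domain →ₗ[ℂ] H') : Set (ℝ × ℝ) :=
  {p | 0 ≤ p.1 ∧ 0 ≤ p.2 ∧
    ∀ φ : S.domain, ‖A φ‖ ^ 2 ≤ p.1 ^ 2 * ‖(φ : H)‖ ^ 2 + p.2 ^ 2 * ‖S φ‖ ^ 2}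

/-- `A` is relatively bounded with respect to `S`. -/
def IsRelBounded (S : H →ₗ.[ℂ] H) (A : S.domain →ₗ[ℂ] H') : Prop :=
  (relBoundPairs S A).Nonempty

/-- The `S`-bound of an `S`-bounded operator `A`. -/
noncomputable def relBound (S : H →ₗ.[ℂ] H) (A : S.domain →ₗ[ℂ] H') : ℝ :=
  sInf {b : ℝ | ∃ a : ℝ, (a, b) ∈ relBoundPairs S A}

end RelativelyBounded

section EnergyNorm

variable {H : Type*} [NormedAddCommGroup H] [InnerProductSpace ℂ H] [CompleteSpace H]

/-- The set `𝔅_G(H)` of all `√G`-bounded operators `A : D(√G) → H`. -/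
def opBG (G : H →ₗ.[ℂ] H) : Set ((sqrtOp G).domain →ₗ[ℂ] H) :=
  {A | IsRelBounded (sqrtOp G) A}

/-- The set `𝔅⁰_G(H)` of all `√G`-infinitesimal operators: the `√G`-bounded operators with
`√G`-bound zero. -/
def opBG0 (G : H →ₗ.[ℂ] H) : Set ((sqrtOp G).domain →ₗ[ℂ] H) :=
  {A | IsRelBounded (sqrtOp G) A ∧ relBound (sqrtOp G) A = 0}

/-- The operator `E`-norm `‖A‖^G_E`: the supremum of `‖A φ‖` over all unit vectors `φ` in `D(√G)`
with `‖√G φ‖² ≤ E`. -/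
noncomputable def opENorm (G : H →ₗ.[ℂ] H) (A : (sqrtOp G).domain →ₗ[ℂ] H) (E : ℝ) : ℝ :=
  sSup {r : ℝ | ∃ φ : (sqrtOp G).domain, ‖(φ : H)‖ = 1 ∧ ‖sqrtOp G φ‖ ^ 2 ≤ E ∧ r = ‖A φ‖}

end EnergyNorm

section Tensor

variable {H : Type*} [NormedAddCommGroup H] [InnerProductSpace ℂ H]
  (K : Type*) [NormedAddCommGroup K] [InnerProductSpace ℂ K]

/-- The Hilbert space tensor product: the completion of the algebraic tensor product with respect
to the inner product `⟨φ ⊗ ψ, φ' ⊗ ψ'⟩ = ⟨φ, φ'⟩ ⟨ψ, ψ'⟩`. -/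
abbrev HilbertTensor (H K : Type*) [NormedAddCommGroup H] [InnerProductSpace ℂ H]
    [NormedAddCommGroup K] [InnerProductSpace ℂ K] : Type _ :=
  UniformSpace.Completion (H ⊗[ℂ] K)

/-- For a subspace `D` of `H`, the embedding of the algebraic tensor product `D ⊗ K` into the
Hilbert space tensor product of `H` and `K`. -/
noncomputable def tensorIncl (D : Submodule ℂ H) : D ⊗[ℂ] K →ₗᵢ[ℂ] HilbertTensor H K :=
  (UniformSpace.Completion.toComplₗᵢ : H ⊗[ℂ] K →ₗᵢ[ℂ] UniformSpace.Completion (H ⊗[ℂ] K)).comp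
    (TensorProduct.mapIsometry D.subtypeₗᵢ LinearIsometry.id)

theorem tensorIncl_injective (D : Submodule ℂ H) :
    Function.Injective (tensorIncl K D).toLinearMap :=
  fun _ _ h => (tensorIncl K D).injective h

/-- For `A : D → H` linear, the map `φ ⊗ ψ ↦ A φ ⊗ ψ` from the algebraic tensor product `D ⊗ K`
to the Hilbert space tensor product of `H` and `K`. -/
noncomputable def tensorApply {D : Submodule ℂ H} (A : D →ₗ[ℂ] H) :
    D ⊗[ℂ] K →ₗ[ℂ] HilbertTensor H K :=
  (UniformSpace.Completion.toComplₗᵢ :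
    H ⊗[ℂ] K →ₗᵢ[ℂ] UniformSpace.Completion (H ⊗[ℂ] K)).toLinearMap.comp (A.rTensor K)

/-- The operator `S ⊗ I_K` with domain the linear span of all `φ ⊗ ψ`, `φ ∈ D(S)`, `ψ ∈ K`. -/
noncomputable def algAmpl (S : H →ₗ.[ℂ] H) : HilbertTensor H K →ₗ.[ℂ] HilbertTensor H K where
  domain := LinearMap.range (tensorIncl K S.domain).toLinearMap
  toFun := (tensorApply K S.toFun).comp
    (LinearEquiv.ofInjective (tensorIncl K S.domain).toLinearMap
      (tensorIncl_injective K S.domain)).symm.toLinearMap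

/-- For a self-adjoint `S`, the self-adjoint operator `S ⊗ I_K`: the closure of the operator
`S ⊗ I_K` on the linear span of all `φ ⊗ ψ`, `φ ∈ D(S)`, `ψ ∈ K`. -/
noncomputable def ampl (S : H →ₗ.[ℂ] H) : HilbertTensor H K →ₗ.[ℂ] HilbertTensor H K :=
  (algAmpl K S).closure

theorem tensorIncl_mem_ampl_domain (S : H →ₗ.[ℂ] H) (t : S.domain ⊗[ℂ] K) :
    tensorIncl K S.domain t ∈ (ampl K S).domain :=
  (LinearPMap.le_closure (algAmpl K S)).1 (LinearMap.mem_range_self _ t)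

/-- `T` is an `S ⊗ I_K`-bounded linear extension to `D(S ⊗ I_K)` of the operator `A ⊗ I_K`
(`φ ⊗ ψ ↦ A φ ⊗ ψ`) on the linear span of all `φ ⊗ ψ`, `φ ∈ D(S)`, `ψ ∈ K`. -/
structure IsAmplExtension (S : H →ₗ.[ℂ] H) (A : S.domain →ₗ[ℂ] H)
    (T : (ampl K S).domain →ₗ[ℂ] HilbertTensor H K) : Prop where
  extends_tensor : ∀ t : S.domain ⊗[ℂ] K,
    T ⟨tensorIncl K S.domain t, tensorIncl_mem_ampl_domain K S t⟩ = tensorApply K A t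
  isRelBounded : IsRelBounded (ampl K S) T

/-- The set of all `η` in the domain of `√G ⊗ I_K` such that `‖(√G ⊗ I_K) η‖² ≤ E`. -/
def energySet [CompleteSpace H] (G : H →ₗ.[ℂ] H) (E : ℝ) : Set (ampl K (sqrtOp G)).domain :=
  {η | ‖ampl K (sqrtOp G) η‖ ^ 2 ≤ E}

end Tensor

/-! ### Merging several vectors into one (joint numerical range) -/

section JointNumericalRange

variable {D F : Type*} [NormedAddCommGroup D] [InnerProductSpace ℂ D]
  [NormedAddCommGroup F] [InnerProductSpace ℂ F]

/-! Everything on the tensor product is reduced to single vectors of `H`. Expanding an algebraic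
tensor along an orthonormal system of `K` turns its norm, its energy and the norm of its image under
`A ⊗ I` into sums of squares over finitely many vectors. A Toeplitz–Hausdorff argument
(`exists_norm_sq_eq_add`) merges these vectors into one with the same total norm and energy, on
which `A` is at least as large.

Hence `A ⊗ I` obeys on algebraic tensors the same relative bound as `A`. These tensors are dense in
the graph of `√G ⊗ I`, so `A ⊗ I` extends uniquely. The same reduction bounds the extension by
`‖A‖^G_E` on vectors of norm at most 1 and energy at most `E`; that the supremum over unit vectors
also controls shorter ones uses unit vectors of arbitrarily small energy, which `hGinf` supplies.

Rescaling `η - θ` by `1/ε` gives the quantitative estimate. Its right side is at most `√(ε² a² + 4E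
b²)` for every admissible pair `(a, b)`, so it tends to 0 when `b` can be taken arbitrarily small.
If the relative bound is positive, vectors of fixed energy and vanishing norm keep images bounded
away from zero, and tensoring them with a unit vector of `K` breaks continuity at 0. -/

theorem norm_sq_rotation_add (x y : F) (θ : ℝ) :
    ‖((Real.cos θ : ℝ) : ℂ) • x + ((Real.sin θ : ℝ) : ℂ) • y‖ ^ 2 +
      ‖((-Real.sin θ : ℝ) : ℂ) • x + ((Real.cos θ : ℝ) : ℂ) • y‖ ^ 2 = ‖x‖ ^ 2 + ‖y‖ ^ 2 := by
  have h : ∀ c s : ℝ, ‖(c : ℂ) • x + (s : ℂ) • y‖ ^ 2 =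
      c ^ 2 * ‖x‖ ^ 2 + 2 * (c * s * (inner ℂ x y).re) + s ^ 2 * ‖y‖ ^ 2 := by
    intro c s
    rw [@norm_add_sq ℂ, norm_smul, norm_smul, mul_pow, mul_pow, inner_smul_left, inner_smul_right]
    simp [mul_assoc]
  rw [h, h]
  linear_combination (‖x‖ ^ 2 + ‖y‖ ^ 2) * Real.sin_sq_add_cos_sq θ

/-- A two-vector form of the convexity of the joint numerical range (Toeplitz–Hausdorff). -/
theorem exists_norm_sq_eq_add (A B : D →ₗ[ℂ] F) (x y : D) :
    ∃ z : D, ‖z‖ ^ 2 = ‖x‖ ^ 2 + ‖y‖ ^ 2 ∧ ‖B z‖ ^ 2 = ‖B x‖ ^ 2 + ‖B y‖ ^ 2 ∧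
      ‖A x‖ ^ 2 + ‖A y‖ ^ 2 ≤ ‖A z‖ ^ 2 := by
  set n := ‖x‖ ^ 2 + ‖y‖ ^ 2 with hn
  set p := ‖B x‖ ^ 2 + ‖B y‖ ^ 2 with hp
  set q := ‖A x‖ ^ 2 + ‖A y‖ ^ 2 with hq
  rcases (show 0 ≤ n by positivity).eq_or_lt with h0 | h0
  · have hx : ‖x‖ ^ 2 = 0 := by nlinarith [sq_nonneg ‖x‖, sq_nonneg ‖y‖]
    have hy : ‖y‖ ^ 2 = 0 := by nlinarith [sq_nonneg ‖x‖, sq_nonneg ‖y‖]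
    have hx' : x = 0 := by simpa using hx
    have hy' : y = 0 := by simpa using hy
    exact ⟨0, by simp [← h0], by simp [hp, hx', hy'], by simp [hq, hx', hy']⟩
  -- Only ratios matter: a nonzero `u` with the right ratios can be rescaled to have squared norm
  -- `n`.
  suffices h : ∃ u : D, u ≠ 0 ∧ n * ‖B u‖ ^ 2 = p * ‖u‖ ^ 2 ∧ q * ‖u‖ ^ 2 ≤ n * ‖A u‖ ^ 2 by
    obtain ⟨u, hu, h1, h2⟩ := h
    have hu' : 0 < ‖u‖ ^ 2 := by positivity
    have hr : ‖((√(n / ‖u‖ ^ 2) : ℝ) : ℂ)‖ ^ 2 = n / ‖u‖ ^ 2 := by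
      rw [Complex.norm_real, Real.norm_eq_abs, sq_abs, Real.sq_sqrt (by positivity)]
    refine ⟨((√(n / ‖u‖ ^ 2) : ℝ) : ℂ) • u, ?_, ?_, ?_⟩
    · rw [norm_smul, mul_pow, hr]
      field_simp
    · rw [map_smul, norm_smul, mul_pow, hr]
      field_simp
      linarith
    · rw [map_smul, norm_smul, mul_pow, hr, div_mul_eq_mul_div, le_div_iff₀ hu']
      exact h2
  -- Rotating the pair `(x, y)` preserves the sum over the pair of each of the three quadratic
  -- forms.
  let z : ℝ → D := fun θ => ((Real.cos θ : ℝ) : ℂ) • x + ((Real.sin θ : ℝ) : ℂ) • y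
  let w : ℝ → D := fun θ => ((-Real.sin θ : ℝ) : ℂ) • x + ((Real.cos θ : ℝ) : ℂ) • y
  have hN : ∀ θ, ‖z θ‖ ^ 2 + ‖w θ‖ ^ 2 = n := fun θ => norm_sq_rotation_add x y θ
  have hL : ∀ (C : D →ₗ[ℂ] F) θ, ‖C (z θ)‖ ^ 2 + ‖C (w θ)‖ ^ 2 = ‖C x‖ ^ 2 + ‖C y‖ ^ 2 := by
    intro C θ
    simp only [z, w, map_add, map_smul]
    exact norm_sq_rotation_add (C x) (C y) θ
  let g : ℝ → ℝ := fun θ => n * ‖B (z θ)‖ ^ 2 - p * ‖z θ‖ ^ 2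
  have hg : Continuous g := by
    simp only [g, z, map_add, map_smul]
    fun_prop
  have hg0 : g 0 = n * ‖B x‖ ^ 2 - p * ‖x‖ ^ 2 := by simp [g, z]
  have hg1 : g (Real.pi / 2) = - g 0 := by
    rw [hg0]
    simp only [g, z, Real.cos_pi_div_two, Real.sin_pi_div_two, Complex.ofReal_zero, zero_smul,
      zero_add, Complex.ofReal_one, one_smul]
    rw [hn, hp]
    ring
  -- A quarter turn carries `x` to `y` and changes the sign of `g`, so the intermediate value
  -- theorem applies.
  obtain ⟨θ, hθ⟩ : ∃ θ, g θ = 0 := by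
    rcases le_total (g 0) 0 with h | h
    · exact mem_range_of_exists_le_of_exists_ge hg ⟨0, h⟩ ⟨Real.pi / 2, by rw [hg1]; linarith⟩
    · exact mem_range_of_exists_le_of_exists_ge hg ⟨Real.pi / 2, by rw [hg1]; linarith⟩ ⟨0, h⟩
  have hz : n * ‖B (z θ)‖ ^ 2 = p * ‖z θ‖ ^ 2 := sub_eq_zero.1 hθ
  have hw : n * ‖B (w θ)‖ ^ 2 = p * ‖w θ‖ ^ 2 := by
    linear_combination n * hL B θ - p * hN θ - hz
  -- The defects of `A` at `z θ` and `w θ` cancel, so one of them is nonnegative. It remains to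
  -- ensure that the chosen vector is nonzero.
  have hA : (n * ‖A (z θ)‖ ^ 2 - q * ‖z θ‖ ^ 2) + (n * ‖A (w θ)‖ ^ 2 - q * ‖w θ‖ ^ 2) = 0 := by
    linear_combination n * hL A θ - q * hN θ
  by_cases hz0 : z θ = 0
  · refine ⟨w θ, fun hw0 => ?_, hw, ?_⟩
    · have := hN θ
      rw [hz0, hw0] at this
      simp at this
      exact h0.ne this
    · rw [hz0] at hA
      simp at hA
      linarith
  by_cases hw0 : w θ = 0
  · refine ⟨z θ, hz0, hz, ?_⟩
    rw [hw0] at hA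
    simp at hA
    linarith
  rcases le_total 0 (n * ‖A (z θ)‖ ^ 2 - q * ‖z θ‖ ^ 2) with h | h
  · exact ⟨z θ, hz0, hz, by linarith⟩
  · exact ⟨w θ, hw0, hw, by linarith⟩

theorem exists_norm_sq_eq_sum (A B : D →ₗ[ℂ] F) {n : ℕ} (φ : Fin n → D) :
    ∃ z : D, ‖z‖ ^ 2 = ∑ i, ‖φ i‖ ^ 2 ∧ ‖B z‖ ^ 2 = ∑ i, ‖B (φ i)‖ ^ 2 ∧
      ∑ i, ‖A (φ i)‖ ^ 2 ≤ ‖A z‖ ^ 2 := by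
  induction n with
  | zero => exact ⟨0, by simp, by simp, by simp⟩
  | succ n ih =>
    obtain ⟨z, h1, h2, h3⟩ := ih fun i => φ i.castSucc
    obtain ⟨w, k1, k2, k3⟩ := exists_norm_sq_eq_add A B z (φ (Fin.last n))
    refine ⟨w, ?_, ?_, ?_⟩
    · rw [Fin.sum_univ_castSucc, k1, h1]
    · rw [Fin.sum_univ_castSucc, k2, h2]
    · rw [Fin.sum_univ_castSucc]
      linarith

end JointNumericalRange

/-! ### Orthonormal expansions of algebraic tensors -/

section AlgebraicTensor

variable {E F K : Type*} [NormedAddCommGroup E] [InnerProductSpace ℂ E]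
  [NormedAddCommGroup F] [InnerProductSpace ℂ F] [NormedAddCommGroup K] [InnerProductSpace ℂ K]

/-- A tensor involves only a finite-dimensional subspace of `K`, and an orthonormal basis of that
subspace gives the expansion. -/
theorem exists_orthonormal_sum_tmul (t : E ⊗[ℂ] K) :
    ∃ (n : ℕ) (φ : Fin n → E) (e : Fin n → K), Orthonormal ℂ e ∧ t = ∑ i, φ i ⊗ₜ[ℂ] e i := by
  obtain ⟨E', K', _, _, h⟩ :=
    TensorProduct.exists_finite_submodule_of_setFinite {t} (Set.finite_singleton t)
  obtain ⟨s, rfl⟩ := Set.singleton_subset_iff.mp h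
  let e := stdOrthonormalBasis ℂ K'
  have hs : ∃ φ : Fin (Module.finrank ℂ K') → E', s = ∑ i, φ i ⊗ₜ[ℂ] e i := by
    induction s with
    | zero => exact ⟨0, by simp⟩
    | tmul x k =>
      refine ⟨fun i => e.repr k i • x, ?_⟩
      conv_lhs => rw [← e.sum_repr k]
      simp [TensorProduct.tmul_sum, TensorProduct.smul_tmul]
    | add a b ha hb =>
      obtain ⟨φ, hφ⟩ := ha (by simp)
      obtain ⟨χ, hχ⟩ := hb (by simp)
      refine ⟨φ + χ, ?_⟩
      simp only [Pi.add_apply, TensorProduct.add_tmul, Finset.sum_add_distrib]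
      rw [← hφ, ← hχ]
  obtain ⟨φ, rfl⟩ := hs
  refine ⟨_, fun i => φ i, fun i => e i, ?_, ?_⟩
  · exact e.orthonormal.comp_linearIsometry K'.subtypeₗᵢ
  · simp [TensorProduct.mapIncl]

theorem norm_sq_sum_tmul {n : ℕ} (φ : Fin n → F) {e : Fin n → K} (he : Orthonormal ℂ e) :
    ‖∑ i, φ i ⊗ₜ[ℂ] e i‖ ^ 2 = ∑ i, ‖φ i‖ ^ 2 := by
  have h : inner ℂ (∑ i, φ i ⊗ₜ[ℂ] e i) (∑ i, φ i ⊗ₜ[ℂ] e i) = ∑ i, inner ℂ (φ i) (φ i) := by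
    rw [sum_inner]
    refine Finset.sum_congr rfl fun i _ => ?_
    rw [inner_sum]
    simp [orthonormal_iff_ite.1 he]
  rw [@norm_sq_eq_re_inner ℂ, h, map_sum]
  exact Finset.sum_congr rfl fun i _ => (@norm_sq_eq_re_inner ℂ _ _ _ _ _).symm

end AlgebraicTensor

/-! ### The closed operator `S ⊗ I` and its core of algebraic tensors -/

section Amplification

variable {H : Type*} [NormedAddCommGroup H] [InnerProductSpace ℂ H]
  (K : Type*) [NormedAddCommGroup K] [InnerProductSpace ℂ K]

@[simp] theorem tensorIncl_tmul (D : Submodule ℂ H) (x : D) (k : K) :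
    tensorIncl K D (x ⊗ₜ k) = (((x : H) ⊗ₜ[ℂ] k : H ⊗[ℂ] K) : HilbertTensor H K) := rfl

@[simp] theorem tensorApply_tmul {D : Submodule ℂ H} (A : D →ₗ[ℂ] H) (x : D) (k : K) :
    tensorApply K A (x ⊗ₜ k) = ((A x ⊗ₜ[ℂ] k : H ⊗[ℂ] K) : HilbertTensor H K) := rfl

theorem norm_tensorApply {D : Submodule ℂ H} (A : D →ₗ[ℂ] H) (t : D ⊗[ℂ] K) :
    ‖tensorApply K A t‖ = ‖A.rTensor K t‖ :=
  UniformSpace.Completion.norm_coe _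

/-- The norms of `t`, `(S ⊗ I) t` and `(A ⊗ I) t` are controlled by those of a single vector. -/
theorem exists_vector_of_tensor {D : Submodule ℂ H} (S A : D →ₗ[ℂ] H) (t : D ⊗[ℂ] K) :
    ∃ z : D, ‖z‖ = ‖tensorIncl K D t‖ ∧ ‖S z‖ = ‖tensorApply K S t‖ ∧
      ‖tensorApply K A t‖ ≤ ‖A z‖ := by
  obtain ⟨n, φ, e, he, rfl⟩ := exists_orthonormal_sum_tmul t
  obtain ⟨z, h1, h2, h3⟩ := exists_norm_sq_eq_sum A S φ
  have hC : ∀ C : D →ₗ[ℂ] H, ‖tensorApply K C (∑ i, φ i ⊗ₜ[ℂ] e i)‖ ^ 2 = ∑ i, ‖C (φ i)‖ ^ 2 := by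
    intro C
    rw [norm_tensorApply, map_sum]
    simp only [LinearMap.rTensor_tmul]
    exact norm_sq_sum_tmul (fun i => C (φ i)) he
  refine ⟨z, ?_, ?_, ?_⟩
  · rw [LinearIsometry.norm_map, ← sq_eq_sq₀ (norm_nonneg _) (norm_nonneg _), h1,
      norm_sq_sum_tmul φ he]
  · rw [← sq_eq_sq₀ (norm_nonneg _) (norm_nonneg _), h2, hC]
  · rw [← sq_le_sq₀ (norm_nonneg _) (norm_nonneg _), hC]
    exact h3

theorem dense_range_tensorIncl {D : Submodule ℂ H} (hD : Dense (D : Set H)) :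
    Dense (LinearMap.range (tensorIncl K D).toLinearMap : Set (HilbertTensor H K)) := by
  set R := LinearMap.range (tensorIncl K D).toLinearMap
  have h1 : ∀ (x : H) (k : K), ((x ⊗ₜ[ℂ] k : H ⊗[ℂ] K) : HilbertTensor H K) ∈
      R.topologicalClosure := by
    intro x k
    have hc : Continuous fun x : H => ((x ⊗ₜ[ℂ] k : H ⊗[ℂ] K) : HilbertTensor H K) :=
      (UniformSpace.Completion.continuous_coe _).comp
        (TensorProduct.continuous_tmul.comp (continuous_id.prodMk continuous_const))
    refine map_mem_closure (s := (D : Set H)) hc (hD x) fun y hy => ?_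
    exact ⟨(⟨y, hy⟩ : D) ⊗ₜ k, rfl⟩
  have h2 : ∀ t : H ⊗[ℂ] K, (t : HilbertTensor H K) ∈ R.topologicalClosure := by
    intro t
    induction t with
    | zero => exact UniformSpace.Completion.coe_zero (α := H ⊗[ℂ] K) ▸ zero_mem _
    | tmul x k => exact h1 x k
    | add a b ha hb =>
      rw [UniformSpace.Completion.coe_add]
      exact add_mem ha hb
  have h3 : (Set.range ((↑) : H ⊗[ℂ] K → HilbertTensor H K)) ⊆ closure (R : Set _) := by
    rintro _ ⟨t, rfl⟩
    exact h2 t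
  have h4 := UniformSpace.Completion.denseRange_coe.mono h3
  exact dense_closure.1 h4

theorem algAmpl_apply (S : H →ₗ.[ℂ] H) (t : S.domain ⊗[ℂ] K)
    (h : tensorIncl K S.domain t ∈ (algAmpl K S).domain) :
    algAmpl K S ⟨tensorIncl K S.domain t, h⟩ = tensorApply K S.toFun t := by
  change tensorApply K S.toFun ((LinearEquiv.ofInjective (tensorIncl K S.domain).toLinearMap
      (tensorIncl_injective K S.domain)).symm ⟨tensorIncl K S.domain t, h⟩) = _
  congr 1
  exact (LinearEquiv.ofInjective (tensorIncl K S.domain).toLinearMap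
      (tensorIncl_injective K S.domain)).symm_apply_apply t

theorem ampl_tensorIncl (S : H →ₗ.[ℂ] H) (t : S.domain ⊗[ℂ] K) :
    ampl K S ⟨tensorIncl K S.domain t, tensorIncl_mem_ampl_domain K S t⟩ =
      tensorApply K S.toFun t := by
  rw [← algAmpl_apply K S t (LinearMap.mem_range_self _ t)]
  exact ((LinearPMap.le_closure (algAmpl K S)).2 rfl).symm

theorem inner_tensorApply_tensorIncl {D : Submodule ℂ H} {S : D →ₗ[ℂ] H}
    (hS : ∀ x y : D, inner ℂ (S x) (y : H) = inner ℂ (x : H) (S y)) (s t : D ⊗[ℂ] K) :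
    inner ℂ (tensorApply K S s) (tensorIncl K D t) =
      inner ℂ (tensorIncl K D s) (tensorApply K S t) := by
  induction s with
  | zero => rw [(tensorApply K S).map_zero, (tensorIncl K D).map_zero, inner_zero_left,
      inner_zero_left]
  | add a b ha hb => simp only [map_add, inner_add_left, ha, hb]
  | tmul x k =>
    induction t with
    | zero => rw [(tensorApply K S).map_zero, (tensorIncl K D).map_zero, inner_zero_right,
        inner_zero_right]
    | add a b ha hb => simp only [map_add, inner_add_right, ha, hb]
    | tmul y l => simp [UniformSpace.Completion.inner_coe, hS]

variable [CompleteSpace H]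

theorem IsSelfAdjoint.isFormalAdjoint {S : H →ₗ.[ℂ] H} (hS : IsSelfAdjoint S) :
    S.IsFormalAdjoint S := by
  have h := LinearPMap.adjoint_isFormalAdjoint hS.dense_domain
  rwa [LinearPMap.isSelfAdjoint_def.1 hS] at h

/-- A densely defined symmetric operator is contained in its adjoint, which is closed. -/
theorem algAmpl_isClosable {S : H →ₗ.[ℂ] H} (hS : IsSelfAdjoint S) :
    (algAmpl K S).IsClosable := by
  have hd : Dense ((algAmpl K S).domain : Set (HilbertTensor H K)) :=
    dense_range_tensorIncl K hS.dense_domain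
  have hf : (algAmpl K S).IsFormalAdjoint (algAmpl K S) := by
    rintro ⟨_, s, rfl⟩ ⟨_, t, rfl⟩
    have h := inner_tensorApply_tensorIncl K (S := S.toFun)
      (fun x y => hS.isFormalAdjoint x y) s t
    rw [← algAmpl_apply K S s (LinearMap.mem_range_self _ s),
      ← algAmpl_apply K S t (LinearMap.mem_range_self _ t)] at h
    exact h
  exact (LinearPMap.adjoint_isClosed hd).isClosable.leIsClosable (hf.le_adjoint hd)

open Filter in
-- By closability the graph of `S ⊗ I` is the closure of the graph on algebraic tensors, so these
-- form a core.
theorem exists_seq_tendsto_ampl {S : H →ₗ.[ℂ] H} (hS : IsSelfAdjoint S) (η : (ampl K S).domain) :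
    ∃ t : ℕ → S.domain ⊗[ℂ] K,
      Tendsto (fun n => tensorIncl K S.domain (t n)) atTop (𝓝 (η : HilbertTensor H K)) ∧
      Tendsto (fun n => tensorApply K S.toFun (t n)) atTop (𝓝 (ampl K S η)) := by
  have h : ((η : HilbertTensor H K), ampl K S η) ∈ (ampl K S).graph := LinearPMap.mem_graph _ η
  change _ ∈ (algAmpl K S).closure.graph at h
  rw [← (algAmpl_isClosable K hS).graph_closure_eq_closure_graph] at h
  obtain ⟨u, hu, hlim⟩ := mem_closure_iff_seq_limit.1 h
  have hu' : ∀ n, ∃ t : S.domain ⊗[ℂ] K,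
      u n = (tensorIncl K S.domain t, tensorApply K S.toFun t) := by
    intro n
    obtain ⟨⟨_, t, rfl⟩, h1, h2⟩ := (LinearPMap.mem_graph_iff _).1 (hu n)
    refine ⟨t, Prod.ext h1.symm ?_⟩
    rw [← algAmpl_apply K S t (LinearMap.mem_range_self _ t)]
    exact h2.symm
  choose t ht using hu'
  refine ⟨t, ?_, ?_⟩
  · exact ((continuous_fst.tendsto _).comp hlim).congr fun n => by simp [ht]
  · exact ((continuous_snd.tendsto _).comp hlim).congr fun n => by simp [ht]

end Amplification

/-! ### Relative bounds and the extension of `A ⊗ I` -/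

section Extension

open Filter

variable {H : Type*} [NormedAddCommGroup H] [InnerProductSpace ℂ H]

theorem IsRelBounded.tendsto {H' : Type*} [NormedAddCommGroup H'] [InnerProductSpace ℂ H']
    {S : H →ₗ.[ℂ] H} {A : S.domain →ₗ[ℂ] H'} (hA : IsRelBounded S A)
    {u : ℕ → S.domain} {x : S.domain} (h1 : Tendsto (fun n => (u n : H)) atTop (𝓝 x))
    (h2 : Tendsto (fun n => S (u n)) atTop (𝓝 (S x))) :
    Tendsto (fun n => A (u n)) atTop (𝓝 (A x)) := by
  obtain ⟨⟨a, b⟩, ha, hb, h⟩ := hA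
  rw [tendsto_iff_norm_sub_tendsto_zero] at h1 h2 ⊢
  have h3 : Tendsto (fun n => a * ‖(u n : H) - x‖ + b * ‖S (u n) - S x‖) atTop (𝓝 0) := by
    simpa using (h1.const_mul a).add (h2.const_mul b)
  refine squeeze_zero (fun n => norm_nonneg _) (fun n => ?_) h3
  have h4 := h (u n - x)
  rw [map_sub, LinearPMap.map_sub, Submodule.coe_sub] at h4
  dsimp only at ha hb h4
  refine abs_le_of_sq_le_sq' (h4.trans ?_) (by positivity) |>.2
  have : 0 ≤ (a * ‖(u n : H) - x‖) * (b * ‖S (u n) - S x‖) := by positivity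
  nlinarith

theorem norm_le_of_mem_relBoundPairs {S : H →ₗ.[ℂ] H} {A : S.domain →ₗ[ℂ] H} {a b E : ℝ}
    (h : (a, b) ∈ relBoundPairs S A) {φ : S.domain} (h1 : ‖(φ : H)‖ = 1) (h2 : ‖S φ‖ ^ 2 ≤ E) :
    ‖A φ‖ ≤ √(a ^ 2 + b ^ 2 * E) := by
  refine Real.le_sqrt_of_sq_le ((h.2.2 φ).trans ?_)
  dsimp only
  rw [h1]
  gcongr
  simp

theorem relBoundPairs_bddBelow {H' : Type*} [NormedAddCommGroup H'] [InnerProductSpace ℂ H']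
    (S : H →ₗ.[ℂ] H) (A : S.domain →ₗ[ℂ] H') :
    BddBelow {b : ℝ | ∃ a : ℝ, (a, b) ∈ relBoundPairs S A} :=
  ⟨0, fun _ ⟨_, h⟩ => h.2.1⟩

/-- If the relative bound is nonzero, there are vectors of fixed energy, arbitrarily small norm, and
image bounded away from zero. -/
theorem exists_small_vector_of_relBound_ne_zero {S : H →ₗ.[ℂ] H} {A : S.domain →ₗ[ℂ] H}
    (hA : IsRelBounded S A) (hA0 : relBound S A ≠ 0) {E : ℝ} (hE : 0 < E) :
    ∃ c : ℝ, 0 < c ∧ ∀ δ : ℝ, 0 < δ → ∃ φ : S.domain, ‖φ‖ ^ 2 ≤ δ ∧ ‖S φ‖ ^ 2 = E ∧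
      c ≤ ‖A φ‖ ^ 2 := by
  obtain ⟨⟨a₀, b₀⟩, ha₀, hb₀, h₀⟩ := hA
  dsimp only at ha₀ hb₀ h₀
  have hpos : 0 < relBound S A :=
    lt_of_le_of_ne (Real.sInf_nonneg fun _ ⟨_, h⟩ => h.2.1) hA0.symm
  set b := relBound S A / 2 with hb
  have hb' : 0 < b := by positivity
  refine ⟨b ^ 2 * E, by positivity, fun δ hδ => ?_⟩
  -- Half the relative bound is not admissible with any `a`, in particular not with `a² = m`.
  -- Against the known bound `(a₀, b₀)`, the term `a₀²` cancels and `b₀² E / δ` forces `E ‖φ‖² ≤ δ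
  -- ‖S φ‖²`, which is what rescaling to energy `E` needs.
  set m := a₀ ^ 2 + b₀ ^ 2 * E / δ with hm
  have hm0 : 0 ≤ m := by positivity
  have hnot : (√m, b) ∉ relBoundPairs S A := fun h => by
    have : relBound S A ≤ b := csInf_le (relBoundPairs_bddBelow S A) ⟨_, h⟩
    linarith
  obtain ⟨φ, hφ⟩ : ∃ φ : S.domain, m * ‖(φ : H)‖ ^ 2 + b ^ 2 * ‖S φ‖ ^ 2 < ‖A φ‖ ^ 2 := by
    by_contra! h
    exact hnot ⟨Real.sqrt_nonneg _, hb'.le, fun φ => by simpa [Real.sq_sqrt hm0] using h φ⟩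
  have hup := h₀ φ
  have hSφ : 0 < ‖S φ‖ ^ 2 := by
    refine lt_of_le_of_ne (sq_nonneg _) fun h => ?_
    rw [← h] at hφ hup
    have : 0 ≤ b₀ ^ 2 * E / δ * ‖(φ : H)‖ ^ 2 := by positivity
    nlinarith
  have hr : ‖((√(E / ‖S φ‖ ^ 2) : ℝ) : ℂ)‖ ^ 2 = E / ‖S φ‖ ^ 2 := by
    rw [Complex.norm_real, Real.norm_eq_abs, sq_abs, Real.sq_sqrt (by positivity)]
  have hsmall : E * ‖(φ : H)‖ ^ 2 ≤ δ * ‖S φ‖ ^ 2 := by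
    have h1 : b₀ ^ 2 * E / δ * ‖(φ : H)‖ ^ 2 < b₀ ^ 2 * ‖S φ‖ ^ 2 := by
      nlinarith [mul_pos (pow_pos hb' 2) hSφ]
    have hb0 : 0 < b₀ ^ 2 := by
      refine lt_of_le_of_ne (sq_nonneg _) fun h => ?_
      rw [← h] at h1
      simp at h1
    have h2 : b₀ ^ 2 * (E / δ * ‖(φ : H)‖ ^ 2) < b₀ ^ 2 * ‖S φ‖ ^ 2 := by
      convert h1 using 1
      ring
    have h3 := (lt_of_mul_lt_mul_left h2 hb0.le).le
    rw [div_mul_eq_mul_div, div_le_iff₀ hδ] at h3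
    linarith
  refine ⟨((√(E / ‖S φ‖ ^ 2) : ℝ) : ℂ) • φ, ?_, ?_, ?_⟩
  · rw [norm_smul, mul_pow, hr, div_mul_eq_mul_div, div_le_iff₀ hSφ]
    exact hsmall
  · rw [LinearPMap.map_smul, norm_smul, mul_pow, hr, div_mul_cancel₀ _ hSφ.ne']
  · rw [map_smul, norm_smul, mul_pow, hr, div_mul_eq_mul_div, le_div_iff₀ hSφ]
    have : b ^ 2 * ‖S φ‖ ^ 2 ≤ ‖A φ‖ ^ 2 := by
      have : 0 ≤ m * ‖(φ : H)‖ ^ 2 := by positivity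
      linarith
    nlinarith

variable (K : Type*) [NormedAddCommGroup K] [InnerProductSpace ℂ K] [CompleteSpace H]

/-- An extension of `A ⊗ I` is determined by its values along suitable algebraic tensors. -/
theorem IsAmplExtension.exists_seq_tendsto {S : H →ₗ.[ℂ] H} (hS : IsSelfAdjoint S)
    (A : S.domain →ₗ[ℂ] H) (η : (ampl K S).domain) :
    ∃ t : ℕ → S.domain ⊗[ℂ] K,
      Tendsto (fun n => tensorIncl K S.domain (t n)) atTop (𝓝 (η : HilbertTensor H K)) ∧
      Tendsto (fun n => tensorApply K S.toFun (t n)) atTop (𝓝 (ampl K S η)) ∧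
      ∀ T : (ampl K S).domain →ₗ[ℂ] HilbertTensor H K, IsAmplExtension K S A T →
        Tendsto (fun n => tensorApply K A (t n)) atTop (𝓝 (T η)) := by
  obtain ⟨t, h1, h2⟩ := exists_seq_tendsto_ampl K hS η
  refine ⟨t, h1, h2, fun T hT => ?_⟩
  simp only [← hT.extends_tensor]
  refine hT.isRelBounded.tendsto h1 ?_
  simpa only [ampl_tensorIncl] using h2

/-- On algebraic tensors, merging into one vector bounds `A ⊗ I` by `a + b` times the graph norm of
`S ⊗ I`. Density in the graph then allows extension by continuity. -/
theorem exists_isAmplExtension {S : H →ₗ.[ℂ] H} (hS : IsSelfAdjoint S)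
    {A : S.domain →ₗ[ℂ] H} (hA : IsRelBounded S A) :
    ∃ T : (ampl K S).domain →ₗ[ℂ] HilbertTensor H K, IsAmplExtension K S A T := by
  obtain ⟨⟨a, b⟩, ha, hb, h⟩ := hA
  dsimp only at ha hb h
  let e : S.domain ⊗[ℂ] K →ₗ[ℂ] (ampl K S).graph :=
    ((tensorIncl K S.domain).toLinearMap.prod (tensorApply K S.toFun)).codRestrict _ fun t => by
      change (tensorIncl K S.domain t, tensorApply K S.toFun t) ∈ _
      rw [← ampl_tensorIncl K S t]
      exact LinearPMap.mem_graph _ ⟨_, tensorIncl_mem_ampl_domain K S t⟩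
  have he : ∀ t, (e t : HilbertTensor H K × HilbertTensor H K) =
      (tensorIncl K S.domain t, tensorApply K S.toFun t) := fun t => rfl
  have hdense : DenseRange e := by
    rintro ⟨p, hp⟩
    obtain ⟨η, h1, h2⟩ := (LinearPMap.mem_graph_iff _).1 hp
    obtain ⟨t, ht1, ht2⟩ := exists_seq_tendsto_ampl K hS η
    refine mem_closure_of_tendsto (f := fun n => e (t n)) (b := atTop) ?_
      (Eventually.of_forall fun n => Set.mem_range_self _)
    rw [tendsto_subtype_rng]
    have := ht1.prodMk_nhds ht2
    rw [h1, h2] at this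
    exact this
  have hnorm : ∀ t, ‖tensorApply K A t‖ ≤ (a + b) * ‖e t‖ := by
    intro t
    obtain ⟨z, hz1, hz2, hz3⟩ := exists_vector_of_tensor K S.toFun A t
    refine hz3.trans (abs_le_of_sq_le_sq' ((h z).trans ?_) (by positivity)).2
    have h1 : ‖(z : H)‖ ≤ ‖e t‖ := by
      change ‖z‖ ≤ _
      rw [hz1]
      exact norm_fst_le (e t : HilbertTensor H K × HilbertTensor H K)
    have h2 : ‖S z‖ ≤ ‖e t‖ := by
      change ‖S.toFun z‖ ≤ _
      rw [hz2]
      exact norm_snd_le (e t : HilbertTensor H K × HilbertTensor H K)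
    calc a ^ 2 * ‖(z : H)‖ ^ 2 + b ^ 2 * ‖S z‖ ^ 2
        ≤ a ^ 2 * ‖e t‖ ^ 2 + b ^ 2 * ‖e t‖ ^ 2 := by gcongr
      _ ≤ ((a + b) * ‖e t‖) ^ 2 := by nlinarith [mul_nonneg (mul_nonneg ha hb) (sq_nonneg ‖e t‖)]
  let L := (tensorApply K A).extendOfNorm e
  have hL : ∀ x, ‖L x‖ ≤ (a + b) * ‖x‖ := fun x =>
    LinearMap.norm_extendOfNorm_apply_le hdense _ hnorm x
  let i : (ampl K S).domain →ₗ[ℂ] (ampl K S).graph :=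
    ((ampl K S).domain.subtype.prod (ampl K S).toFun).codRestrict _ fun η =>
      LinearPMap.mem_graph _ η
  refine ⟨L.toLinearMap.comp i, fun t => ?_, (a + b, a + b), add_nonneg ha hb,
    add_nonneg ha hb, fun η => ?_⟩
  · have : i ⟨tensorIncl K S.domain t, tensorIncl_mem_ampl_domain K S t⟩ = e t :=
      Subtype.ext (Prod.ext rfl (ampl_tensorIncl K S t))
    change L (i _) = _
    rw [this]
    exact LinearMap.extendOfNorm_eq hdense ⟨_, hnorm⟩ t
  · have h1 : ‖L (i η)‖ ^ 2 ≤ ((a + b) * ‖i η‖) ^ 2 := by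
      gcongr
      exact hL _
    have h2 : ‖i η‖ ^ 2 ≤ ‖(η : HilbertTensor H K)‖ ^ 2 + ‖ampl K S η‖ ^ 2 := by
      change ‖((η : HilbertTensor H K), ampl K S η)‖ ^ 2 ≤ _
      rcases max_choice ‖(η : HilbertTensor H K)‖ ‖ampl K S η‖ with h | h <;>
        rw [Prod.norm_mk, h] <;> nlinarith [sq_nonneg ‖(η : HilbertTensor H K)‖,
          sq_nonneg ‖ampl K S η‖]
    change ‖L (i η)‖ ^ 2 ≤ (a + b) ^ 2 * _ + (a + b) ^ 2 * _
    nlinarith [sq_nonneg (a + b)]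

theorem existsUnique_isAmplExtension {S : H →ₗ.[ℂ] H} (hS : IsSelfAdjoint S)
    {A : S.domain →ₗ[ℂ] H} (hA : IsRelBounded S A) :
    ∃! T : (ampl K S).domain →ₗ[ℂ] HilbertTensor H K, IsAmplExtension K S A T := by
  obtain ⟨T, hT⟩ := exists_isAmplExtension K hS hA
  refine ⟨T, hT, fun T' hT' => LinearMap.ext fun η => ?_⟩
  obtain ⟨t, -, -, h⟩ := IsAmplExtension.exists_seq_tendsto K hS A η
  exact tendsto_nhds_unique (h T' hT') (h T hT)

end Extension

/-! ### Energy-norm estimates, continuity and its failure -/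

section EnergyEstimates

open Filter

variable {H : Type*} [NormedAddCommGroup H] [InnerProductSpace ℂ H] [CompleteSpace H]
  {G : H →ₗ.[ℂ] H}

/-- For a unit vector `φ` in `D(G)`, `‖√G φ‖² = ⟨φ, G φ⟩ ≤ ‖G φ‖` by Cauchy–Schwarz. -/
theorem exists_unit_vector_norm_sqrtOp_sq_le (hG : IsSelfAdjoint G) (hp : IsPosSemidefOp G)
    (hunb : ¬ ∃ c : ℝ, ∀ φ : G.domain, ‖G φ‖ ≤ c * ‖(φ : H)‖)
    (hinf : sInf {r : ℝ | ∃ φ : G.domain, ‖(φ : H)‖ = 1 ∧ r = ‖G φ‖} = 0)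
    {δ : ℝ} (hδ : 0 < δ) :
    ∃ χ : (sqrtOp G).domain, ‖χ‖ = 1 ∧ ‖sqrtOp G χ‖ ^ 2 ≤ δ := by
  -- The real `sInf` of the empty set is 0, so `hinf` alone yields no vector; unboundedness rules
  -- out a zero domain.
  have hne : {r : ℝ | ∃ φ : G.domain, ‖(φ : H)‖ = 1 ∧ r = ‖G φ‖}.Nonempty := by
    obtain ⟨φ, hφ⟩ : ∃ φ : G.domain, φ ≠ 0 := by
      by_contra! h
      exact hunb ⟨0, fun φ => by simp [h φ]⟩
    refine ⟨_, ((‖(φ : H)‖⁻¹ : ℝ) : ℂ) • φ, ?_, rfl⟩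
    have : ‖(φ : H)‖ ≠ 0 := by simpa using hφ
    simp [norm_smul, this]
  obtain ⟨_, ⟨φ, hφ, rfl⟩, hlt⟩ := exists_lt_of_csInf_lt hne (hinf.trans_lt hδ)
  have hS := isPosSqrtOp_sqrtOp hG hp
  obtain ⟨z, hz1, hz2⟩ := (hS.sq_eq φ (G φ)).1 (LinearPMap.mem_graph _ φ)
  obtain ⟨x, hx1, hx2⟩ := (LinearPMap.mem_graph_iff _).1 hz1
  obtain ⟨y, hy1, hy2⟩ := (LinearPMap.mem_graph_iff _).1 hz2
  dsimp only at hx1 hx2 hy1 hy2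
  have hx : ‖x‖ = 1 := by rw [Submodule.coe_norm, hx1, hφ]
  refine ⟨x, hx, ?_⟩
  have h := hS.isSelfAdjoint.isFormalAdjoint x y
  rw [hy1, hx2, hy2, hx1] at h
  rw [hx2, @norm_sq_eq_re_inner ℂ, h]
  calc _ ≤ ‖(φ : H)‖ * ‖G φ‖ := re_inner_le_norm _ _
    _ ≤ δ := by rw [hφ, one_mul]; exact hlt.le

theorem opENorm_nonneg (A : (sqrtOp G).domain →ₗ[ℂ] H) (E : ℝ) : 0 ≤ opENorm G A E := by
  refine Real.sSup_nonneg ?_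
  rintro _ ⟨φ, -, -, rfl⟩
  exact norm_nonneg _

theorem opENorm_le {A : (sqrtOp G).domain →ₗ[ℂ] H} {a b : ℝ}
    (h : (a, b) ∈ relBoundPairs (sqrtOp G) A) (E : ℝ) : opENorm G A E ≤ √(a ^ 2 + b ^ 2 * E) := by
  refine Real.sSup_le ?_ (Real.sqrt_nonneg _)
  rintro _ ⟨φ, h1, h2, rfl⟩
  exact norm_le_of_mem_relBoundPairs h h1 h2

theorem norm_le_opENorm {A : (sqrtOp G).domain →ₗ[ℂ] H} (hA : A ∈ opBG G) {E : ℝ}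
    {φ : (sqrtOp G).domain} (h1 : ‖φ‖ = 1) (h2 : ‖sqrtOp G φ‖ ^ 2 ≤ E) :
    ‖A φ‖ ≤ opENorm G A E := by
  obtain ⟨⟨a, b⟩, h⟩ := hA
  refine le_csSup ⟨√(a ^ 2 + b ^ 2 * E), ?_⟩ ⟨φ, h1, h2, rfl⟩
  rintro _ ⟨φ, h1, h2, rfl⟩
  exact norm_le_of_mem_relBoundPairs h h1 h2

/-- The supremum defining the operator `E`-norm may be taken over the unit ball, provided that
unit vectors of arbitrarily small energy exist. -/
theorem norm_le_opENorm_of_norm_le_one {A : (sqrtOp G).domain →ₗ[ℂ] H} (hA : A ∈ opBG G)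
    (hlow : ∀ δ > 0, ∃ χ : (sqrtOp G).domain, ‖χ‖ = 1 ∧ ‖sqrtOp G χ‖ ^ 2 ≤ δ)
    {E : ℝ} {φ : (sqrtOp G).domain} (h1 : ‖φ‖ ≤ 1) (h2 : ‖sqrtOp G φ‖ ^ 2 < E) :
    ‖A φ‖ ≤ opENorm G A E := by
  -- The strict inequality leaves an energy gap for `χ`; the factor `c` below supplies the missing
  -- norm, and merging `φ` with `c • χ` gives a unit vector of energy at most `E`.
  obtain ⟨χ, hχ1, hχ2⟩ := hlow (E - ‖sqrtOp G φ‖ ^ 2) (by linarith)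
  have hs : 0 ≤ 1 - ‖φ‖ ^ 2 := by nlinarith [norm_nonneg φ]
  set c : ℂ := ((√(1 - ‖φ‖ ^ 2) : ℝ) : ℂ) with hc
  have hc2 : ‖c‖ ^ 2 = 1 - ‖φ‖ ^ 2 := by
    rw [hc, Complex.norm_real, Real.norm_eq_abs, sq_abs, Real.sq_sqrt hs]
  obtain ⟨z, hz1, hz2, hz3⟩ := exists_norm_sq_eq_add A (sqrtOp G).toFun φ (c • χ)
  rw [norm_smul, mul_pow, hc2, hχ1] at hz1
  rw [map_smul, norm_smul, mul_pow, hc2] at hz2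
  have hz1' : ‖z‖ = 1 := by
    rw [← sq_eq_sq₀ (norm_nonneg _) zero_le_one, hz1]
    ring
  have hz2' : ‖sqrtOp G z‖ ^ 2 ≤ E := by
    change ‖(sqrtOp G).toFun z‖ ^ 2 ≤ E
    rw [hz2]
    change ‖sqrtOp G φ‖ ^ 2 + (1 - ‖φ‖ ^ 2) * ‖sqrtOp G χ‖ ^ 2 ≤ E
    nlinarith [sq_nonneg ‖φ‖, sq_nonneg ‖sqrtOp G χ‖]
  refine le_trans ?_ (norm_le_opENorm hA hz1' hz2')
  rw [← sq_le_sq₀ (norm_nonneg _) (norm_nonneg _)]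
  linarith [sq_nonneg ‖A (c • χ)‖]

variable {K : Type*} [NormedAddCommGroup K] [InnerProductSpace ℂ K]

theorem IsAmplExtension.norm_le_opENorm {A : (sqrtOp G).domain →ₗ[ℂ] H}
    {T : (ampl K (sqrtOp G)).domain →ₗ[ℂ] HilbertTensor H K}
    (hT : IsAmplExtension K (sqrtOp G) A T) (hS : IsSelfAdjoint (sqrtOp G)) (hA : A ∈ opBG G)
    (hlow : ∀ δ > 0, ∃ χ : (sqrtOp G).domain, ‖χ‖ = 1 ∧ ‖sqrtOp G χ‖ ^ 2 ≤ δ)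
    {E : ℝ} (hE : 0 < E) {η : (ampl K (sqrtOp G)).domain} (h1 : ‖(η : HilbertTensor H K)‖ ≤ 1)
    (h2 : ‖ampl K (sqrtOp G) η‖ ^ 2 ≤ E) : ‖T η‖ ≤ opENorm G A E := by
  -- Strict constraints persist along approximating algebraic tensors; the boundary case follows by
  -- scaling with `r → 1⁻`.
  have key : ∀ ζ : (ampl K (sqrtOp G)).domain, ‖(ζ : HilbertTensor H K)‖ < 1 →
      ‖ampl K (sqrtOp G) ζ‖ ^ 2 < E → ‖T ζ‖ ≤ opENorm G A E := by
    intro ζ hζ1 hζ2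
    obtain ⟨t, ht1, ht2, ht3⟩ := IsAmplExtension.exists_seq_tendsto K hS A ζ
    refine le_of_tendsto (ht3 T hT).norm ?_
    filter_upwards [ht1.norm.eventually_lt_const hζ1,
      (ht2.norm.pow 2).eventually_lt_const hζ2] with n hn1 hn2
    obtain ⟨z, hz1, hz2, hz3⟩ := exists_vector_of_tensor K (sqrtOp G).toFun A (t n)
    refine hz3.trans (norm_le_opENorm_of_norm_le_one hA hlow (hz1.trans_le hn1.le) ?_)
    change ‖(sqrtOp G).toFun z‖ ^ 2 < E
    rwa [hz2]
  have hlim : Tendsto (fun r : ℝ => r * ‖T η‖) (𝓝[<] 1) (𝓝 ‖T η‖) := by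
    have : Tendsto (fun r : ℝ => r * ‖T η‖) (𝓝 1) (𝓝 (1 * ‖T η‖)) :=
      tendsto_id.mul_const _
    rw [one_mul] at this
    exact this.mono_left nhdsWithin_le_nhds
  refine le_of_tendsto hlim ?_
  filter_upwards [Ioo_mem_nhdsLT zero_lt_one] with r hr
  have hrn : ‖(r : ℂ)‖ = r := by
    rw [Complex.norm_real, Real.norm_eq_abs, abs_of_pos hr.1]
  have h := key ((r : ℂ) • η) ?_ ?_
  · rwa [map_smul, norm_smul, hrn] at h
  · rw [Submodule.coe_smul, norm_smul, hrn]
    nlinarith [hr.1, hr.2]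
  · rw [LinearPMap.map_smul, norm_smul, hrn, mul_pow]
    have hr2 : r ^ 2 < 1 := by nlinarith [hr.1, hr.2]
    have hr0 : 0 < r ^ 2 := pow_pos hr.1 2
    nlinarith

theorem IsAmplExtension.norm_sub_le {A : (sqrtOp G).domain →ₗ[ℂ] H}
    {T : (ampl K (sqrtOp G)).domain →ₗ[ℂ] HilbertTensor H K}
    (hT : IsAmplExtension K (sqrtOp G) A T) (hS : IsSelfAdjoint (sqrtOp G)) (hA : A ∈ opBG G)
    (hlow : ∀ δ > 0, ∃ χ : (sqrtOp G).domain, ‖χ‖ = 1 ∧ ‖sqrtOp G χ‖ ^ 2 ≤ δ)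
    {E ε : ℝ} (hE : 0 < E) (hε : 0 < ε) {η θ : (ampl K (sqrtOp G)).domain}
    (hη : η ∈ energySet K G E) (hθ : θ ∈ energySet K G E)
    (h : ‖(η : HilbertTensor H K) - θ‖ ≤ ε) :
    ‖T (η - θ)‖ ≤ ε * opENorm G A (4 * E / ε ^ 2) := by
  have hc : ‖((ε⁻¹ : ℝ) : ℂ)‖ = ε⁻¹ := by
    rw [Complex.norm_real, Real.norm_eq_abs, abs_of_pos (inv_pos.2 hε)]
  have h1 := hT.norm_le_opENorm hS hA hlow (E := 4 * E / ε ^ 2) (by positivity)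
    (η := ((ε⁻¹ : ℝ) : ℂ) • (η - θ)) ?_ ?_
  · rw [map_smul, norm_smul, hc, inv_mul_le_iff₀ hε] at h1
    exact h1
  · rw [Submodule.coe_smul, norm_smul, hc, inv_mul_le_iff₀ hε, mul_one]
    exact h
  · rw [LinearPMap.map_smul, norm_smul, hc, mul_pow, inv_pow, LinearPMap.map_sub, div_eq_inv_mul]
    -- The triangle inequality bounds the energy of `η - θ` by `(2√E)²`, whence the 4.
    have hη' : ‖ampl K (sqrtOp G) η‖ ≤ √E := Real.le_sqrt_of_sq_le hη
    have hθ' : ‖ampl K (sqrtOp G) θ‖ ≤ √E := Real.le_sqrt_of_sq_le hθ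
    have h3 : ‖ampl K (sqrtOp G) η - ampl K (sqrtOp G) θ‖ ^ 2 ≤ (√E + √E) ^ 2 := by
      gcongr
      exact (_root_.norm_sub_le _ _).trans (add_le_add hη' hθ')
    gcongr
    nlinarith [Real.sq_sqrt hE.le]

theorem tendsto_mul_opENorm {A : (sqrtOp G).domain →ₗ[ℂ] H} (hA : A ∈ opBG0 G) {E : ℝ}
    (hE : 0 < E) :
    Tendsto (fun ε : ℝ => ε * opENorm G A (4 * E / ε ^ 2)) (𝓝[>] 0) (𝓝 0) := by
  obtain ⟨⟨⟨a₀, b₀⟩, h₀⟩, hb⟩ := hA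
  refine tendsto_order.2 ⟨fun c hc => ?_, fun c hc => ?_⟩
  · filter_upwards [self_mem_nhdsWithin] with ε hε
    exact hc.trans_le (mul_nonneg (le_of_lt hε) (opENorm_nonneg A _))
  -- For `b` below this threshold the limiting bound `b √(4E)` is less than `c`.
  have hpos : 0 < c / (2 * √(4 * E)) := by positivity
  have hne : {b : ℝ | ∃ a : ℝ, (a, b) ∈ relBoundPairs (sqrtOp G) A}.Nonempty := ⟨b₀, a₀, h₀⟩
  obtain ⟨b, ⟨a, hab⟩, hlt⟩ := exists_lt_of_csInf_lt hne (hb.trans_lt hpos)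
  have hb0 : 0 ≤ b := hab.2.1
  have hlim : Tendsto (fun ε : ℝ => √(ε ^ 2 * a ^ 2 + b ^ 2 * (4 * E))) (𝓝[>] 0)
      (𝓝 √(0 ^ 2 * a ^ 2 + b ^ 2 * (4 * E))) := by
    have : Continuous fun ε : ℝ => √(ε ^ 2 * a ^ 2 + b ^ 2 * (4 * E)) := by fun_prop
    exact (this.tendsto 0).mono_left nhdsWithin_le_nhds
  have hval : √(0 ^ 2 * a ^ 2 + b ^ 2 * (4 * E)) < c := by
    rw [zero_pow two_ne_zero, zero_mul, zero_add, Real.sqrt_mul (sq_nonneg b),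
      Real.sqrt_sq hb0]
    rw [lt_div_iff₀ (by positivity)] at hlt
    nlinarith [mul_nonneg hb0 (Real.sqrt_nonneg (4 * E))]
  filter_upwards [self_mem_nhdsWithin, hlim.eventually_lt_const hval] with ε hε hlt'
  have hε' : 0 < ε := hε
  refine lt_of_le_of_lt ?_ hlt'
  calc ε * opENorm G A (4 * E / ε ^ 2) ≤ ε * √(a ^ 2 + b ^ 2 * (4 * E / ε ^ 2)) := by
        gcongr
        exact opENorm_le hab _
    _ = √(ε ^ 2 * a ^ 2 + b ^ 2 * (4 * E)) := by
        rw [← Real.sqrt_sq hε'.le, ← Real.sqrt_mul (sq_nonneg ε), Real.sqrt_sq hε'.le]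
        congr 1
        field_simp

theorem IsAmplExtension.not_continuousOn [Nontrivial K] {A : (sqrtOp G).domain →ₗ[ℂ] H}
    {T : (ampl K (sqrtOp G)).domain →ₗ[ℂ] HilbertTensor H K}
    (hT : IsAmplExtension K (sqrtOp G) A T) (hA : A ∈ opBG G) (hA0 : A ∉ opBG0 G)
    {E : ℝ} (hE : 0 < E) : ¬ ContinuousOn T (energySet K G E) := by
  intro hcont
  obtain ⟨c, hc, h⟩ := exists_small_vector_of_relBound_ne_zero hA (fun h => hA0 ⟨hA, h⟩) hE
  obtain ⟨ψ, hψ⟩ : ∃ ψ : K, ‖ψ‖ = 1 := by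
    obtain ⟨ψ, hψ⟩ := exists_ne (0 : K)
    exact ⟨((‖ψ‖⁻¹ : ℝ) : ℂ) • ψ, by simp [norm_smul, hψ]⟩
  have h0 : (0 : (ampl K (sqrtOp G)).domain) ∈ energySet K G E := by
    simp [energySet, LinearPMap.map_zero, hE.le]
  obtain ⟨δ, hδ, hδ'⟩ := Metric.continuousOn_iff.1 hcont 0 h0 (√c) (Real.sqrt_pos.2 hc)
  -- Then `φ ⊗ ψ` has norm at most `δ / 2` and energy `E`, while its image has norm at least `√c`.
  obtain ⟨φ, hφ1, hφ2, hφ3⟩ := h ((δ / 2) ^ 2) (by positivity)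
  have hnorm : ∀ (B : (sqrtOp G).domain →ₗ[ℂ] H), ‖tensorApply K B (φ ⊗ₜ ψ)‖ = ‖B φ‖ := by
    intro B
    rw [norm_tensorApply, LinearMap.rTensor_tmul, TensorProduct.norm_tmul, hψ, mul_one]
  have h1 := hδ' ⟨tensorIncl K _ (φ ⊗ₜ ψ), tensorIncl_mem_ampl_domain K _ _⟩ ?_ ?_
  · rw [map_zero, dist_zero_right, hT.extends_tensor, hnorm] at h1
    exact h1.not_ge (Real.sqrt_le_iff.2 ⟨norm_nonneg _, hφ3⟩)
  · change ‖_‖ ^ 2 ≤ E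
    rw [ampl_tensorIncl, hnorm]
    exact hφ2.le
  · rw [dist_zero_right, Submodule.coe_norm, LinearIsometry.norm_map, TensorProduct.norm_tmul, hψ,
      mul_one]
    have := abs_le_of_sq_le_sq' hφ1 (by positivity)
    linarith [this.2]

end EnergyEstimates

/-! ### The main theorem -/

theorem proposition7
    {H : Type*} [NormedAddCommGroup H] [InnerProductSpace ℂ H] [CompleteSpace H]
    [TopologicalSpace.SeparableSpace H]
    {K : Type*} [NormedAddCommGroup K] [InnerProductSpace ℂ K] [CompleteSpace K]
    [TopologicalSpace.SeparableSpace K] [Nontrivial K]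
    (G : H →ₗ.[ℂ] H) (hG : IsSelfAdjoint G) (hGpos : IsPosSemidefOp G)
    (hGunb : ¬ ∃ c : ℝ, ∀ φ : G.domain, ‖G φ‖ ≤ c * ‖(φ : H)‖)
    (hGinf : sInf {r : ℝ | ∃ φ : G.domain, ‖(φ : H)‖ = 1 ∧ r = ‖G φ‖} = 0)
    (A : (sqrtOp G).domain →ₗ[ℂ] H) (hA : A ∈ opBG G) :
    (∃! T : (ampl K (sqrtOp G)).domain →ₗ[ℂ] HilbertTensor H K,
      IsAmplExtension K (sqrtOp G) A T) ∧
    ∀ T : (ampl K (sqrtOp G)).domain →ₗ[ℂ] HilbertTensor H K,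
      IsAmplExtension K (sqrtOp G) A T →
      (A ∈ opBG0 G → ∀ E : ℝ, 0 < E →
        UniformContinuousOn T (energySet K G E) ∧
        (∀ ε : ℝ, 0 < ε → ∀ η ∈ energySet K G E, ∀ θ ∈ energySet K G E,
          ‖(η : HilbertTensor H K) - θ‖ ≤ ε →
            ‖T (η - θ)‖ ≤ ε * opENorm G A (4 * E / ε ^ 2)) ∧
        Filter.Tendsto (fun ε : ℝ => ε * opENorm G A (4 * E / ε ^ 2)) (𝓝[>] 0) (𝓝 0)) ∧
      (A ∉ opBG0 G → ∀ E : ℝ, 0 < E → ¬ ContinuousOn T (energySet K G E)) := by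
  have hS : IsSelfAdjoint (sqrtOp G) := (isPosSqrtOp_sqrtOp hG hGpos).isSelfAdjoint
  refine ⟨existsUnique_isAmplExtension K hS hA, fun T hT => ⟨fun hA0 E hE => ?_,
    fun hA0 E hE => hT.not_continuousOn hA hA0 hE⟩⟩
  have hquant : ∀ ε : ℝ, 0 < ε → ∀ η ∈ energySet K G E, ∀ θ ∈ energySet K G E,
      ‖(η : HilbertTensor H K) - θ‖ ≤ ε → ‖T (η - θ)‖ ≤ ε * opENorm G A (4 * E / ε ^ 2) :=
    fun ε hε η hη θ hθ h => hT.norm_sub_le hS hA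
      (fun δ hδ => exists_unit_vector_norm_sqrtOp_sq_le hG hGpos hGunb hGinf hδ) hE hε hη hθ h
  have hlim := tendsto_mul_opENorm hA0 hE
  refine ⟨Metric.uniformContinuousOn_iff.2 fun r hr => ?_, hquant, hlim⟩
  -- An `ε` whose quantitative bound is below `r` serves as the modulus of uniform continuity.
  obtain ⟨ε, hεr, hε⟩ := ((hlim.eventually_lt_const hr).and self_mem_nhdsWithin).exists
  refine ⟨ε, hε, fun η hη θ hθ h => ?_⟩
  rw [dist_eq_norm, ← map_sub]
  rw [dist_eq_norm] at h
  exact (hquant ε hε η hη θ hθ h.le).trans_lt hεr
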